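/- Let $\Omega$ be a locally compact Hausdorff space and let $C_0(\Omega)$ be the vector lattice (with the pointwise order) of continuous functions $\Omega\to\mathbb R$ vanishing at infinity. In a vector lattice $X$, a net $(x_\alpha)$ \emph{converges relatively uniformly} to $x$ if there is $e\in X_+$ such that for every $\varepsilon>0$ there is $\alpha_0$ with $|x_\alpha-x|\le\varepsilon e$ for all $\alpha\ge\alpha_0$. This is a locally solid convergence: vector space operations are continuous, and $y_\alpha\to 0$ and $|x_\alpha|\le|y_\alpha|$ for all $\alpha$ imply $x_\alpha\to 0$. The \emph{unbounded modification} $\mathrm u\eta$ of a locally solid convergence $\eta$ is the locally solid convergence in which $x_\alpha\to x$ iff $|x_\alpha-x|\wedge u\to 0$ with respect to $\eta$ for every $u\in X_+$; $\eta$ is \emph{unbounded} if $\mathrm u\eta=\eta$. Then $\Omega$ is compact if and only if relative uniform convergence on $C_0(\Omega)$ is unbounded. Moreover, if relative uniform convergence on $C_0(\Omega)$ is unbounded, then $C_0(\Omega)$ has a strong unit, i.e., there is $e\in C_0(\Omega)_+$ such that for every $f\in C_0(\Omega)$ there is $c\in\mathbb R$ with $|f|\le c\,e$. -/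

import Mathlib

open Filter Topology
open scoped ZeroAtInfty

/-! ### Convergence structures -/

/-- A convergence structure on a set `X`, given by the filters that converge to each point.  A net
`(x α)` converges to `x` when its tail filter `map x atTop` does.  The axioms force the improper
filter `⊥` to converge to every point, so it carries no information: these are exactly the
convergence structures given by proper filters. -/
@[ext]
structure ConvergenceStructure (X : Type*) where
  /-- `Conv F x` means that the filter `F` converges to `x`. -/
  Conv : Filter X → X → Prop
  pure_conv : ∀ x, Conv (pure x) x
  mono : ∀ {F G : Filter X} {x : X}, Conv F x → G ≤ F → Conv G x
  sup : ∀ {F G : Filter X} {x : X}, Conv F x → Conv G x → Conv (F ⊔ G) x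

section VectorLattice

set_option linter.unusedSectionVars false

variable (X : Type*) [AddCommGroup X] [Lattice X] [IsOrderedAddMonoid X]
  [Module ℝ X] [PosSMulMono ℝ X]

/-- A locally solid convergence structure on a real vector lattice: a convergence structure for
which addition `X × X → X` and scalar multiplication `ℝ × X → X` are (jointly) continuous, and such
that the filter generated by the solid hulls of the members of `F` converges to `0` whenever `F`
does. -/
@[ext]
structure LocallySolidConvergence extends ConvergenceStructure X where
  add : ∀ {F G : Filter X} {x y : X}, Conv F x → Conv G y →
    Conv (map (fun p : X × X => p.1 + p.2) (F ×ˢ G)) (x + y)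
  smul : ∀ (r : ℝ) {F : Filter X} {x : X}, Conv F x →
    Conv (map (fun p : ℝ × X => p.1 • p.2) (𝓝 r ×ˢ F)) (r • x)
  solid : ∀ {F : Filter X}, Conv F 0 → Conv (F.lift' LatticeOrderedAddCommGroup.solidClosure) 0

variable {X}

/-- `e` is a strong unit of the vector lattice `X`: `e ≥ 0` and the ideal generated by `e` is `X`.
-/
def IsStrongUnit (e : X) : Prop :=
  0 ≤ e ∧ ∀ x : X, ∃ c : ℝ, |x| ≤ c • e

theorem abs_smul_le_vl (r : ℝ) (x : X) : |r • x| ≤ |r| • |x| := by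
  have key : ∀ (r : ℝ) (x : X), r • x ≤ |r| • |x| := by
    intro r x
    rcases le_total 0 r with h | h
    · rw [abs_of_nonneg h]
      exact smul_le_smul_of_nonneg_left (le_abs_self x) h
    · rw [abs_of_nonpos h, ← neg_smul_neg r x]
      exact smul_le_smul_of_nonneg_left (neg_le_abs x) (neg_nonneg.2 h)
  refine abs_le'.2 ⟨key r x, ?_⟩
  have := key (-r) x
  rwa [neg_smul, abs_neg] at this

theorem smul_nonneg_vl {r : ℝ} {x : X} (hr : 0 ≤ r) (hx : 0 ≤ x) : 0 ≤ r • x := by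
  have := smul_le_smul_of_nonneg_left hx hr
  rwa [smul_zero] at this

theorem smul_le_smul_right_vl {r s : ℝ} {x : X} (h : r ≤ s) (hx : 0 ≤ x) : r • x ≤ s • x := by
  have := smul_nonneg_vl (sub_nonneg.2 h) hx
  rw [sub_smul] at this
  exact sub_nonneg.1 this

theorem abs_smul_sub_smul_le_vl (r s : ℝ) (x y : X) :
    |r • y - s • x| ≤ |r| • |y - x| + |r - s| • |x| := by
  have : r • y - s • x = r • (y - x) + (r - s) • x := by
    rw [smul_sub, sub_smul]; abel
  rw [this]
  exact (abs_add_le _ _).trans (add_le_add (abs_smul_le_vl _ _) (abs_smul_le_vl _ _))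

theorem add_inf_le_vl {a b u : X} (ha : 0 ≤ a) (hb : 0 ≤ b) (hu : 0 ≤ u) :
    (a + b) ⊓ u ≤ a ⊓ u + b ⊓ u := by
  rw [add_inf, inf_add, inf_add]
  refine le_inf (le_inf inf_le_left ?_) (le_inf ?_ ?_)
  · exact inf_le_right.trans (le_add_of_nonneg_right hb)
  · exact inf_le_right.trans (le_add_of_nonneg_left ha)
  · exact inf_le_right.trans (le_add_of_nonneg_left hu)

theorem smul_inf_le_vl {r : ℝ} {w u : X} (hr : 0 ≤ r) (hw : 0 ≤ w) (hu : 0 ≤ u) :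
    (r • w) ⊓ u ≤ (r + 1) • (w ⊓ u) := by
  have hM : 0 < r + 1 := by linarith
  have hMi : 0 ≤ (r + 1)⁻¹ := inv_nonneg.2 hM.le
  have h : (r + 1)⁻¹ • ((r • w) ⊓ u) ≤ w ⊓ u := by
    refine le_inf ?_ ?_
    · refine (smul_le_smul_of_nonneg_left inf_le_left hMi).trans ?_
      rw [smul_smul]
      refine (smul_le_smul_right_vl (s := 1) ?_ hw).trans (one_smul ℝ w).le
      rw [inv_mul_le_iff₀ hM]; linarith
    · refine (smul_le_smul_of_nonneg_left inf_le_right hMi).trans ?_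
      refine (smul_le_smul_right_vl (s := 1) ?_ hu).trans (one_smul ℝ u).le
      exact inv_le_one_of_one_le₀ (by linarith)
  have := smul_le_smul_of_nonneg_left h hM.le
  rwa [smul_smul, mul_inv_cancel₀ hM.ne', one_smul] at this

namespace LocallySolidConvergence

variable (η : LocallySolidConvergence X)

theorem add_map {ι : Type*} {H : Filter ι} {f g : ι → X} {x y : X}
    (hf : η.Conv (map f H) x) (hg : η.Conv (map g H) y) :
    η.Conv (map (fun i => f i + g i) H) (x + y) := by
  refine η.mono (η.add hf hg) ?_
  have h : Tendsto (fun i => (f i, g i)) H (map f H ×ˢ map g H) :=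
    tendsto_map.prodMk tendsto_map
  exact tendsto_map.comp h

theorem smul_map {ι : Type*} {H : Filter ι} {c : ι → ℝ} {f : ι → X} {r : ℝ} {x : X}
    (hc : Tendsto c H (𝓝 r)) (hf : η.Conv (map f H) x) :
    η.Conv (map (fun i => c i • f i) H) (r • x) := by
  refine η.mono (η.smul r hf) ?_
  have h : Tendsto (fun i => (c i, f i)) H (𝓝 r ×ˢ map f H) := hc.prodMk tendsto_map
  exact tendsto_map.comp h

theorem dom_map {ι : Type*} {H : Filter ι} {f g : ι → X}
    (hg : η.Conv (map g H) 0) (hfg : ∀ i, |f i| ≤ |g i|) : η.Conv (map f H) 0 := by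
  refine η.mono (η.solid hg) ?_
  rw [Filter.lift', Filter.lift]
  refine le_iInf₂ fun s hs => le_principal_iff.2 ?_
  refine mem_map.2 (mem_of_superset (mem_map.1 hs) fun i hi => ?_)
  exact ⟨g i, hi, hfg i⟩

variable (X) in
/-- Relative uniform convergence: `F` converges to `x` if there is a regulator `e ≥ 0` such that,
for every `ε > 0`, `|y - x| ≤ ε e` for all `y` in some member of `F`. -/
def relUniform : LocallySolidConvergence X where
  Conv F x := ∃ e : X, 0 ≤ e ∧ ∀ ε : ℝ, 0 < ε → ∀ᶠ y in F, |y - x| ≤ ε • e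
  pure_conv x := ⟨0, le_rfl, fun ε _ => by simp⟩
  mono := by
    rintro F G x ⟨e, he, h⟩ hGF
    exact ⟨e, he, fun ε hε => (h ε hε).filter_mono hGF⟩
  sup := by
    rintro F G x ⟨e, he, h⟩ ⟨e', he', h'⟩
    refine ⟨e + e', add_nonneg he he', fun ε hε => eventually_sup.2 ⟨?_, ?_⟩⟩
    · exact (h ε hε).mono fun y hy => hy.trans
        (smul_le_smul_of_nonneg_left (le_add_of_nonneg_right he') hε.le)
    · exact (h' ε hε).mono fun y hy => hy.trans
        (smul_le_smul_of_nonneg_left (le_add_of_nonneg_left he) hε.le)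
  add := by
    rintro F G x y ⟨e, he, h⟩ ⟨e', he', h'⟩
    refine ⟨e + e', add_nonneg he he', fun ε hε => eventually_map.2 ?_⟩
    refine ((h ε hε).prod_mk (h' ε hε)).mono fun p hp => ?_
    rw [smul_add, add_sub_add_comm]
    exact (abs_add_le _ _).trans (add_le_add hp.1 hp.2)
  smul := by
    rintro r F x ⟨e, he, h⟩
    refine ⟨e + |x|, add_nonneg he (abs_nonneg x), fun ε hε => eventually_map.2 ?_⟩
    have hM : 0 < |r| + 1 := by positivity
    have h1 : ∀ᶠ s in 𝓝 r, |s| ≤ |r| + 1 ∧ |s - r| ≤ ε := by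
      have h2 : Tendsto (fun s : ℝ => |s|) (𝓝 r) (𝓝 |r|) := continuous_abs.tendsto r
      have h3 : Tendsto (fun s : ℝ => |s - r|) (𝓝 r) (𝓝 0) := by
        have : Continuous (fun s : ℝ => |s - r|) := by fun_prop
        simpa using this.tendsto r
      exact (h2.eventually_le_const (by linarith)).and (h3.eventually_le_const hε)
    refine (h1.prod_mk (h (ε / (|r| + 1)) (by positivity))).mono ?_
    rintro ⟨s, y⟩ ⟨⟨hs, hs'⟩, hy⟩
    refine (abs_smul_sub_smul_le_vl s r x y).trans ?_
    rw [smul_add]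
    refine add_le_add ?_ (smul_le_smul_right_vl hs' (abs_nonneg x))
    refine (smul_le_smul_right_vl hs (abs_nonneg _)).trans ?_
    refine (smul_le_smul_of_nonneg_left hy hM.le).trans (le_of_eq ?_)
    rw [smul_smul, mul_div_cancel₀ _ hM.ne']
  solid := by
    rintro F ⟨e, he, h⟩
    refine ⟨e, he, fun ε hε => ?_⟩
    refine mem_of_superset (mem_lift' (h ε hε)) ?_
    rintro y ⟨x, hx, hyx⟩
    simp only [Set.mem_ofPred_eq, sub_zero] at hx ⊢
    exact hyx.trans hx

/-- The unbounded modification of `η`: `F` converges to `x` if, for every `u ≥ 0`, the image of `F`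
under `y ↦ |y - x| ∧ u` is `η`-convergent to `0`. -/
def unboundedModification : LocallySolidConvergence X where
  Conv F x := ∀ u : X, 0 ≤ u → η.Conv (map (fun y => |y - x| ⊓ u) F) 0
  pure_conv x u hu := by
    have h : |x - x| ⊓ u = 0 := by simp [hu]
    rw [map_pure, h]
    exact η.pure_conv 0
  mono h hGF u hu := η.mono (h u hu) (map_mono hGF)
  sup h h' u hu := by
    rw [map_sup]
    exact η.sup (h u hu) (h' u hu)
  add := by
    intro F G x y h h' u hu
    rw [map_map]
    have h1 : η.Conv (map (fun p : X × X => |p.1 - x| ⊓ u) (F ×ˢ G)) 0 :=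
      η.mono (h u hu) (tendsto_map.comp tendsto_fst)
    have h2 : η.Conv (map (fun p : X × X => |p.2 - y| ⊓ u) (F ×ˢ G)) 0 :=
      η.mono (h' u hu) (tendsto_map.comp tendsto_snd)
    have h3 := η.add_map h1 h2
    rw [add_zero] at h3
    refine η.dom_map h3 fun p => ?_
    simp only [Function.comp]
    have ha := abs_nonneg (p.1 - x)
    have hb := abs_nonneg (p.2 - y)
    rw [abs_of_nonneg (le_inf (abs_nonneg _) hu),
      abs_of_nonneg (add_nonneg (le_inf ha hu) (le_inf hb hu)), add_sub_add_comm]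
    exact (inf_le_inf_right u (abs_add_le _ _)).trans (add_inf_le_vl ha hb hu)
  smul := by
    intro r F x h u hu
    rw [map_map]
    have h1 : η.Conv (map (fun p : ℝ × X => |p.2 - x| ⊓ u) (𝓝 r ×ˢ F)) 0 :=
      η.mono (h u hu) (tendsto_map.comp tendsto_snd)
    have c1 : Tendsto (fun p : ℝ × X => |p.1| + 1) (𝓝 r ×ˢ F) (𝓝 (|r| + 1)) := by
      have : Continuous (fun s : ℝ => |s| + 1) := by fun_prop
      exact (this.tendsto r).comp tendsto_fst
    have c2 : Tendsto (fun p : ℝ × X => |p.1 - r|) (𝓝 r ×ˢ F) (𝓝 0) := by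
      have : Continuous (fun s : ℝ => |s - r|) := by fun_prop
      have h := this.tendsto r
      rw [sub_self, abs_zero] at h
      exact h.comp tendsto_fst
    have h2 : η.Conv (map (fun _ : ℝ × X => |x|) (𝓝 r ×ˢ F)) |x| :=
      η.mono (η.pure_conv |x|) tendsto_const_pure
    have h3 := η.add_map (η.smul_map c1 h1) (η.smul_map c2 h2)
    rw [smul_zero, zero_smul, add_zero] at h3
    refine η.dom_map h3 ?_
    rintro ⟨s, y⟩
    simp only [Function.comp]
    have ha := abs_nonneg (y - x)
    have hs := smul_nonneg_vl (abs_nonneg s) ha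
    have hx := smul_nonneg_vl (abs_nonneg (s - r)) (abs_nonneg x)
    have hs1 : (0 : ℝ) ≤ |s| + 1 := by positivity
    rw [abs_of_nonneg (le_inf (abs_nonneg _) hu),
      abs_of_nonneg (add_nonneg (smul_nonneg_vl hs1 (le_inf ha hu)) hx)]
    refine (inf_le_inf_right u (abs_smul_sub_smul_le_vl s r x y)).trans ?_
    refine (add_inf_le_vl hs hx hu).trans ?_
    exact add_le_add (smul_inf_le_vl (abs_nonneg s) ha hu) inf_le_left
  solid := by
    intro F h u hu
    refine η.mono (η.solid (h u hu)) ?_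
    refine le_iInf₂ fun s hs => le_principal_iff.2 ?_
    refine mem_map.2 (mem_of_superset (mem_lift' (mem_map.1 hs)) ?_)
    rintro y ⟨x, hx, hyx⟩
    refine ⟨_, hx, ?_⟩
    rw [abs_of_nonneg (le_inf (abs_nonneg _) hu), abs_of_nonneg (le_inf (abs_nonneg _) hu),
      sub_zero, sub_zero]
    exact inf_le_inf_right u hyx

/-- A locally solid convergence is unbounded if it equals its unbounded modification. -/
def IsUnbounded : Prop := η.unboundedModification = η

end LocallySolidConvergence

end VectorLattice

/-! ### `C₀(Ω)` as a vector lattice, with the pointwise order -/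

namespace ZeroAtInftyContinuousMap

section Order

variable {Ω : Type*} [TopologicalSpace Ω]

instance instPartialOrderReal : PartialOrder C₀(Ω, ℝ) :=
  PartialOrder.lift (fun f => (f : Ω → ℝ)) DFunLike.coe_injective

theorem le_def_real {f g : C₀(Ω, ℝ)} : f ≤ g ↔ ∀ ω, f ω ≤ g ω := Iff.rfl

instance instMaxReal : Max C₀(Ω, ℝ) where
  max f g :=
    { toFun := fun ω => max (f ω) (g ω)
      continuous_toFun := (map_continuous f).max (map_continuous g)
      zero_at_infty' := by
        have h := (zero_at_infty f).max (zero_at_infty g)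
        rwa [max_self] at h }

instance instMinReal : Min C₀(Ω, ℝ) where
  min f g :=
    { toFun := fun ω => min (f ω) (g ω)
      continuous_toFun := (map_continuous f).min (map_continuous g)
      zero_at_infty' := by
        have h := (zero_at_infty f).min (zero_at_infty g)
        rwa [min_self] at h }

instance instLatticeReal : Lattice C₀(Ω, ℝ) where
  sup f g := f ⊔ g
  inf f g := f ⊓ g
  le_sup_left _ _ _ := le_max_left _ _
  le_sup_right _ _ _ := le_max_right _ _
  sup_le _ _ _ h h' ω := max_le (h ω) (h' ω)
  inf_le_left _ _ _ := min_le_left _ _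
  inf_le_right _ _ _ := min_le_right _ _
  le_inf _ _ _ h h' ω := le_min (h ω) (h' ω)

instance instIsOrderedAddMonoidReal : IsOrderedAddMonoid C₀(Ω, ℝ) where
  add_le_add_left _ _ h k ω := add_le_add_left (h ω) (k ω)

instance instPosSMulMonoReal : PosSMulMono ℝ C₀(Ω, ℝ) where
  smul_le_smul_of_nonneg_left _ hr _ _ h ω := mul_le_mul_of_nonneg_left (h ω) hr

theorem sup_apply_real (f g : C₀(Ω, ℝ)) (ω : Ω) : (f ⊔ g) ω = max (f ω) (g ω) := rfl

theorem inf_apply_real (f g : C₀(Ω, ℝ)) (ω : Ω) : (f ⊓ g) ω = min (f ω) (g ω) := rfl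

theorem abs_apply_real (f : C₀(Ω, ℝ)) (ω : Ω) : |f| ω = |f ω| := rfl

end Order

end ZeroAtInftyContinuousMap

/-! If `Ω` is compact, the constant `1` is a strong unit, and the single test element `u = 1`
recovers relative uniform convergence: as soon as `|y - x| ⊓ 1` is uniformly below `1`, the
truncation does nothing. Conversely, functions that vanish on ever larger compact sets converge to
`0` in the unbounded sense, whatever their size elsewhere
(`vanishingOnCompacts_unbounded_conv_zero`). If they also converged relatively uniformly, one
regulator `e` would dominate every function vanishing on some compact `K`; multiples of a Urysohn
bump off `K` rule this out unless `K` is all of `Ω`. -/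

namespace ZeroAtInftyContinuousMap

variable {Ω : Type*} [TopologicalSpace Ω]

/-- The constant function `1`, which vanishes at infinity when `Ω` is compact. -/
def constOne [CompactSpace Ω] : C₀(Ω, ℝ) where
  toFun _ := 1
  continuous_toFun := continuous_const
  zero_at_infty' := by simp

/-- The pointwise square root of a function vanishing at infinity. -/
noncomputable def sqrt (u : C₀(Ω, ℝ)) : C₀(Ω, ℝ) where
  toFun ω := √(u ω)
  continuous_toFun := (map_continuous u).sqrt
  zero_at_infty' := by simpa using (zero_at_infty u).sqrt

theorem isStrongUnit_constOne [CompactSpace Ω] : IsStrongUnit (constOne : C₀(Ω, ℝ)) := by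
  refine ⟨fun ω => zero_le_one, fun f => ?_⟩
  obtain ⟨c, hc⟩ := isCompact_univ.exists_bound_of_continuousOn (map_continuous f).continuousOn
  refine ⟨c, fun ω => ?_⟩
  change |f ω| ≤ c * 1
  rw [mul_one]
  exact hc ω (Set.mem_univ ω)

theorem relUniform_isUnbounded_of_compactSpace [CompactSpace Ω] :
    (LocallySolidConvergence.relUniform C₀(Ω, ℝ)).IsUnbounded := by
  refine LocallySolidConvergence.ext (funext₂ fun F x => propext ⟨fun h => ?_, ?_⟩)
  · obtain ⟨e, he, h⟩ := h constOne isStrongUnit_constOne.1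
    obtain ⟨c, hc⟩ := isStrongUnit_constOne.2 e
    refine ⟨e, he, fun ε hε => ?_⟩
    have hd : 0 < |c| + 1 := by positivity
    -- The bound `(|c| + 1)⁻¹` makes the tolerance times `e` smaller than `1` everywhere, because `e
    -- ≤ c`; this disables the truncation at `1`.
    have hδ : 0 < min ε (|c| + 1)⁻¹ := lt_min hε (inv_pos.2 hd)
    refine (eventually_map.1 (h _ hδ)).mono fun y hy ω => ?_
    have h1 : |min |y ω - x ω| 1 - 0| ≤ min ε (|c| + 1)⁻¹ * e ω := hy ω
    have h2 : |e ω| ≤ c * 1 := hc ω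
    have h3 : 0 ≤ e ω := he ω
    change |y ω - x ω| ≤ ε * e ω
    rw [sub_zero] at h1
    have h4 := (le_abs_self _).trans h1
    have h5 : (|c| + 1)⁻¹ * e ω < 1 := by
      rw [inv_mul_lt_iff₀ hd]
      linarith [le_abs_self (e ω), le_abs_self c]
    have h6 := mul_le_mul_of_nonneg_right (min_le_left ε (|c| + 1)⁻¹) h3
    have h7 := mul_le_mul_of_nonneg_right (min_le_right ε (|c| + 1)⁻¹) h3
    rcases min_le_iff.1 h4 with h8 | h8 <;> linarith
  -- No compactness is needed here: truncating only shrinks, so the same regulator works.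
  · rintro ⟨e, he, h⟩ u hu
    refine ⟨e, he, fun ε hε => eventually_map.2 ((h ε hε).mono fun y hy => ?_)⟩
    rw [sub_zero, abs_of_nonneg (le_inf (abs_nonneg _) hu)]
    exact inf_le_left.trans hy

/-- The filter generated by the sets of functions vanishing on a given compact set. -/
def vanishingOnCompacts (Ω : Type*) [TopologicalSpace Ω] : Filter C₀(Ω, ℝ) :=
  (cocompact Ω).lift' fun s => {f | ∀ ω ∉ s, f ω = 0}

theorem mem_vanishingOnCompacts {S : Set C₀(Ω, ℝ)} :
    S ∈ vanishingOnCompacts Ω ↔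
      ∃ K : Set Ω, IsCompact K ∧ ∀ f : C₀(Ω, ℝ), (∀ ω ∈ K, f ω = 0) → f ∈ S := by
  have hm : Monotone fun s : Set Ω => {f : C₀(Ω, ℝ) | ∀ ω ∉ s, f ω = 0} :=
    fun s t hst f hf ω hω => hf ω fun h => hω (hst h)
  rw [vanishingOnCompacts, (hasBasis_cocompact.lift' hm).mem_iff]
  simp [Set.subset_def]

/-- Off `K` nothing is known about `f`, so only the bound by `u` is left, and `u` is not small
relative to itself. Relative to `√u` it is: `u = √u * √u`, and `√u ≤ ε` off a compact set. -/
theorem vanishingOnCompacts_unbounded_conv_zero :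
    (LocallySolidConvergence.relUniform C₀(Ω, ℝ)).unboundedModification.Conv
      (vanishingOnCompacts Ω) 0 := by
  intro u hu
  refine ⟨sqrt u, fun ω => Real.sqrt_nonneg _, fun ε hε => eventually_map.2 ?_⟩
  have hs : ∀ᶠ ω in cocompact Ω, √(u ω) ≤ ε :=
    (zero_at_infty (sqrt u)).eventually_le_const hε
  obtain ⟨K, hK, hKs⟩ := mem_cocompact.1 hs
  refine mem_vanishingOnCompacts.2 ⟨K, hK, fun f hf ω => ?_⟩
  change |min |f ω - 0| (u ω) - 0| ≤ ε * √(u ω)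
  have hu' : 0 ≤ u ω := hu ω
  rw [sub_zero, sub_zero, abs_of_nonneg (le_min (abs_nonneg _) hu')]
  by_cases hω : ω ∈ K
  · rw [hf ω hω, abs_zero, min_eq_left hu']
    positivity
  · have h : √(u ω) ≤ ε := hKs hω
    calc min |f ω| (u ω) ≤ √(u ω) * √(u ω) := by
          rw [Real.mul_self_sqrt hu']; exact min_le_right _ _
      _ ≤ ε * √(u ω) := mul_le_mul_of_nonneg_right h (Real.sqrt_nonneg _)

theorem compactSpace_of_relUniform_isUnbounded [T2Space Ω] [LocallyCompactSpace Ω]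
    (h : (LocallySolidConvergence.relUniform C₀(Ω, ℝ)).IsUnbounded) : CompactSpace Ω := by
  have hconv := vanishingOnCompacts_unbounded_conv_zero (Ω := Ω)
  rw [h] at hconv
  obtain ⟨e, -, he⟩ := hconv
  -- The single tolerance `1` suffices, since functions vanishing on `K` can be scaled freely.
  obtain ⟨K, hK, hKe⟩ := mem_vanishingOnCompacts.1 (he 1 one_pos)
  refine ⟨?_⟩
  suffices hu : K = Set.univ from hu ▸ hK
  by_contra hne
  obtain ⟨ω, hω⟩ := (Set.ne_univ_iff_exists_notMem K).1 hne
  obtain ⟨f, hf1, hf0, hfc, -⟩ := exists_continuous_one_zero_of_isCompact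
    (isCompact_singleton (x := ω)) hK.isClosed (Set.disjoint_singleton_left.2 hω)
  let g : C₀(Ω, ℝ) := ⟨f, hfc.is_zero_at_infty⟩
  -- As `g ω = 1`, the factor `e ω + 1` pushes the value at `ω` above `e ω`.
  have hle := hKe ((e ω + 1) • g) (fun x hx => by
    change (e ω + 1) * f x = 0
    rw [hf0 hx, Pi.zero_apply, mul_zero]) ω
  change |(e ω + 1) * f ω - 0| ≤ 1 * e ω at hle
  rw [hf1 (Set.mem_singleton ω), Pi.one_apply, mul_one, sub_zero, one_mul] at hle
  linarith [le_abs_self (e ω + 1)]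

end ZeroAtInftyContinuousMap

theorem mainTheorem11 (Ω : Type*) [TopologicalSpace Ω] [T2Space Ω] [LocallyCompactSpace Ω] :
    (CompactSpace Ω ↔ (LocallySolidConvergence.relUniform C₀(Ω, ℝ)).IsUnbounded) ∧
    ((LocallySolidConvergence.relUniform C₀(Ω, ℝ)).IsUnbounded →
      ∃ e : C₀(Ω, ℝ), IsStrongUnit e) := by
  refine ⟨⟨fun _ => ZeroAtInftyContinuousMap.relUniform_isUnbounded_of_compactSpace,
    ZeroAtInftyContinuousMap.compactSpace_of_relUniform_isUnbounded⟩, fun h => ?_⟩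
  have := ZeroAtInftyContinuousMap.compactSpace_of_relUniform_isUnbounded h
  exact ⟨_, ZeroAtInftyContinuousMap.isStrongUnit_constOne⟩
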